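/- **Setting.** A *generic configuration* is a tuple $\xi=(L^\xi,\Delta_0^\xi,B^\xi,d,g)$ as follows. (1) $L^\xi$ is a first-order language with $0,1,2,=,\le,\max$, interpreted in the standard model $\mathbb N$, in which every $k\in\mathbb N$ is the value of a closed term $T_k$. (2) $\Delta_0^\xi$ is a class of formulas all of whose quantifiers are bounded ($\forall v\le t$, $\exists v\le t$), closed under the propositional connectives, quantification bounded by a variable, and substitution of variables and of the terms $T_k$ for variables, and containing formulas that define the graphs of addition and multiplication. A $\Pi_1^\xi$ (resp. $\Sigma_1^\xi$) sentence is $\forall v_1\cdots\forall v_m\,\varphi$ (resp. $\exists v_1\cdots\exists v_m\,\varphi$) with $\varphi\in\Delta_0^\xi$, $m\ge0$; and $\Pi_0^\xi=\Sigma_0^\xi=\Delta_0^\xi$. (3) $B^\xi$ is a set of sentences true in $\mathbb N$ from which $d$ proves every true $\Sigma_1^\xi$ sentence. (4) $d$ is a deduction method; for axiom systems $\alpha\supseteq B^\xi$ it proves every logical consequence of $\alpha$, and it proves $Z$ whenever it proves $X$, $Y$ and $(X\wedge Y)\to Z$. A proof cites finitely many axioms, and is a proof from $\alpha$ when these all lie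 in $\alpha$. (5) $g$ is an injective Gödel numbering $\ulcorner\cdot\urcorner$ of formulas, with proofs coded by natural numbers, such that the number of a proof is at least that of each axiom it cites, and such that the elementary syntactic relations (being a $\Pi_1^\xi$ sentence; a $\Pi_k^\xi$ sentence and its $\Sigma_k^\xi$ negation for $k\le1$; substitution of a numeral; membership in $B^\xi$; correctness of a derivation; citing an axiom) are $\Delta_0$ (equivalently, LinH) relations on $\mathbb N$. For a sentence $\Upsilon$ and an extended real $N$, $\Upsilon$ is $\mathrm{Good}(N)$ if it is true in $\mathbb N$ when its unbounded quantifiers are restricted to numbers $<2^N$. For a set $\theta$ of $\Pi_1^\xi$ sentences, $\sharp(\theta)$ is the largest integer $J$ such that every sentence of $\theta$ is $\mathrm{Good}(J)$ ($\infty$ if there are arbitrarily large such $J$, $-\infty$ if there is none). Put $\mathrm{Log}(p)=\log_2p$ (and $\mathrm{Log}(0)=0$). Consider all r.e. sets $\theta$ of $\Pi_1^\xi$ sentences, true or not, and all proofs $p$ of a sentence $\Upsilon$ from $\theta\cup B^\xi$ with $\mathrm{Log}(p)\le\sharp(\theta)+1$. Then $\xi$ is *A-stable* if in this situation every $\Pi_1^\xi$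 sentence $\Upsilon$ is $\mathrm{Good}(\frac12\sharp(\theta))$; *E-stable* if every $\Sigma_1^\xi$ sentence $\Upsilon$ is $\mathrm{Good}(\frac12\lfloor\mathrm{Log}(p)\rfloor-1)$; *0-stable* if every $\Delta_0^\xi$ sentence $\Upsilon$ is true; and *EA-stable* if it is both E-stable and A-stable. A system $\alpha$ is *Level$(k^\xi)$ consistent* if $d$ does not prove from $\alpha$ both a $\Pi_k^\xi$ sentence and the $\Sigma_k^\xi$ sentence that is its negation. With $\Delta_0^\xi$ formulas defining the relations named, a formal statement of the Level$(k^\xi)$ consistency of $\alpha$ is $$\forall x\,\forall y\,\forall p\,\forall q\;\neg\{\mathrm{Neg}^k(x,y)\wedge\mathrm{Prf}_\alpha(x,p)\wedge\mathrm{Prf}_\alpha(y,q)\},$$ where $\mathrm{Neg}^k(x,y)$ says that $x$ codes a $\Pi_k^\xi$ sentence and $y$ its $\Sigma_k^\xi$ negation. A sentence $\mathrm{SelfCons}^k(\beta,d)$ is a sentence $\Gamma(T_n)$ with $n=\ulcorner\Gamma(g)\urcorner$, where $\Gamma(g)$ is $$\forall x\,\forall y\,\forall p\,\forall q\;\neg\{\mathrm{Neg}^k(x,y)\wedge\mathrm{SubstPrf}_\beta(g,x,p)\wedge\mathrm{SubstPrf}_\beta(g,y,q)\}$$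 and $\mathrm{SubstPrf}_\beta(g,t,p)$ says that $p$ is a proof of $t$ from $\beta$, or from $\beta$ together with a sentence that has Gödel number $h\le p$ and is obtained from the formula with Gödel number $g$ by substituting $T_g$ for its free variable. The system $\alpha$ is *self-justifying, recognizing its Level$(k^\xi)$ consistency,* if $d$ proves from $\alpha$ a formal statement of the Level$(k^\xi)$ consistency of $\alpha$, and $\alpha$ is in fact consistent. $\mathrm{TestList}^\xi$ is the list of all $\Delta_0^\xi$ formulas $\mathrm{Test}_j(t,x)$ such that $\Psi\leftrightarrow\forall x\,\mathrm{Test}_j(\ulcorner\Psi\urcorner,x)$ is true in $\mathbb N$ for every $\Pi_1^\xi$ sentence $\Psi$. Let $(\mathcal B,D)$ be an axiom system, in a language extending $L^\xi$, and a deduction method, whose proof relation for $L^\xi$-sentences is given by a $\Delta_0^\xi$ formula $\mathrm{Prf}_{\mathcal B}^D(t,q)$, and let $\mathrm{Check}(t)$ be a $\Delta_0^\xi$ formula defining the set of codes of $\Pi_1^\xi$ sentences. Then $\mathrm{GlobSim}_{\mathcal B}^D(\xi,j)$ is the sentence $$\forall t\,\forall q\,\forall x\,\{[\mathrm{Prf}_{\mathcal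 B}^D(t,q)\wedge\mathrm{Check}(t)]\to\mathrm{Test}_j(t,x)\}.$$ A $\Pi_1^\xi$ sentence $\Psi$ is $\mathrm{Braced}^\xi(\Phi,j)$ if $d$ proves $\{\forall x\,\mathrm{Test}_j(T_{\ulcorner\Psi\urcorner},x)\}\to\Psi$ from $B^\xi\cup\{\Phi\}$. **Theorem G.2.** Let $\xi$ be a generic configuration, and let $(\mathcal B,D)$ be as above, all of whose $\Pi_1^\xi$ theorems are true in $\mathbb N$. Let $\Phi$ be a $\Pi_1^\xi$ sentence that is true in $\mathbb N$, and let $j$ be an index in $\mathrm{TestList}^\xi$. Let $k=1$ if $\xi$ is EA-stable; or let $k=0$ if $\xi$ is E-stable, A-stable or 0-stable. Then a sentence $G=\mathrm{GlobSim}_{\mathcal B}^D(\xi,j)$ and, for every such $G$, a sentence $S=\mathrm{SelfCons}^k(B^\xi\cup\{\Phi,G\},d)$ exist. For all such $G$ and $S$, both are $\Pi_1^\xi$ sentences, and the system $$\beta_j=B^\xi\cup\{\Phi,G,S\},$$ which adds at most three axioms to $B^\xi$, has the following properties: 1. $\beta_j$ is self-justifying, recognizing its Level$(k^\xi)$ consistency;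 in particular it is Level$(k^\xi)$ consistent and consistent. 2. $\beta_j$ proves every $\Pi_1^\xi$ theorem of $(\mathcal B,D)$ that is a $\mathrm{Braced}^\xi(\Phi,j)$ sentence. -/

import Mathlib

open scoped FirstOrder

namespace SelfJust

universe u v

/-! ## Formulas with bounded and unbounded quantifiers -/

/-- First-order formulas over `L` whose free variables are `x₀, …, xₙ₋₁`.  Unbounded quantifiers
(`all`, `ex`) and bounded quantifiers (`ball t` is `∀ xₙ ≤ t`, `bex t` is `∃ xₙ ≤ t`, with `t` a
term in `x₀, …, xₙ₋₁`) are separate constructs; quantifiers bind the variable of highest index. -/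
inductive Fml (L : FirstOrder.Language.{u, v}) : ℕ → Type (max u v)
  | eq {n : ℕ} (s t : L.Term (Fin n)) : Fml L n
  | rel {n k : ℕ} (R : L.Relations k) (ts : Fin k → L.Term (Fin n)) : Fml L n
  | neg {n : ℕ} (φ : Fml L n) : Fml L n
  | and {n : ℕ} (φ ψ : Fml L n) : Fml L n
  | or {n : ℕ} (φ ψ : Fml L n) : Fml L n
  | imp {n : ℕ} (φ ψ : Fml L n) : Fml L n
  | all {n : ℕ} (φ : Fml L (n + 1)) : Fml L n
  | ex {n : ℕ} (φ : Fml L (n + 1)) : Fml L n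
  | ball {n : ℕ} (t : L.Term (Fin n)) (φ : Fml L (n + 1)) : Fml L n
  | bex {n : ℕ} (t : L.Term (Fin n)) (φ : Fml L (n + 1)) : Fml L n

/-- Sentences: formulas without free variables. -/
abbrev Sent (L : FirstOrder.Language.{u, v}) : Type (max u v) := Fml L 0

namespace Fml

variable {L : FirstOrder.Language.{u, v}}

/-- Extend a substitution under a quantifier. -/
def liftSub {n m : ℕ} (σ : Fin n → L.Term (Fin m)) : Fin (n + 1) → L.Term (Fin (m + 1)) :=
  Fin.snoc (α := fun _ => L.Term (Fin (m + 1)))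
    (fun i => (σ i).relabel Fin.castSucc) (FirstOrder.Language.Term.var (Fin.last m))

/-- Simultaneous (capture-free) substitution of the terms `σ i` for the variables `xᵢ`. -/
def subst : {n m : ℕ} → Fml L n → (Fin n → L.Term (Fin m)) → Fml L m
  | _, _, eq s t, σ => eq (s.subst σ) (t.subst σ)
  | _, _, rel R ts, σ => rel R (fun i => (ts i).subst σ)
  | _, _, neg φ, σ => neg (φ.subst σ)
  | _, _, and φ ψ, σ => and (φ.subst σ) (ψ.subst σ)
  | _, _, or φ ψ, σ => or (φ.subst σ) (ψ.subst σ)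
  | _, _, imp φ ψ, σ => imp (φ.subst σ) (ψ.subst σ)
  | _, _, all φ, σ => all (φ.subst (liftSub σ))
  | _, _, ex φ, σ => ex (φ.subst (liftSub σ))
  | _, _, ball t φ, σ => ball (t.subst σ) (φ.subst (liftSub σ))
  | _, _, bex t φ, σ => bex (t.subst σ) (φ.subst (liftSub σ))

/-- Translation of formulas along a map of languages. -/
def map {L' : FirstOrder.Language.{u, v}} (ι : L →ᴸ L') : {n : ℕ} → Fml L n → Fml L' n
  | _, eq s t => eq (ι.onTerm s) (ι.onTerm t)
  | _, rel R ts => rel (ι.onRelation R) (fun i => ι.onTerm (ts i))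
  | _, neg φ => neg (φ.map ι)
  | _, and φ ψ => and (φ.map ι) (ψ.map ι)
  | _, or φ ψ => or (φ.map ι) (ψ.map ι)
  | _, imp φ ψ => imp (φ.map ι) (ψ.map ι)
  | _, all φ => all (φ.map ι)
  | _, ex φ => ex (φ.map ι)
  | _, ball t φ => ball (ι.onTerm t) (φ.map ι)
  | _, bex t φ => bex (ι.onTerm t) (φ.map ι)

/-- All quantifiers of the formula are bounded. -/
def FullyBounded : {n : ℕ} → Fml L n → Prop
  | _, eq _ _ => True
  | _, rel _ _ => True
  | _, neg φ => φ.FullyBounded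
  | _, and φ ψ => φ.FullyBounded ∧ ψ.FullyBounded
  | _, or φ ψ => φ.FullyBounded ∧ ψ.FullyBounded
  | _, imp φ ψ => φ.FullyBounded ∧ ψ.FullyBounded
  | _, all _ => False
  | _, ex _ => False
  | _, ball _ φ => φ.FullyBounded
  | _, bex _ φ => φ.FullyBounded

/-- The negation of a prenex formula, in prenex form: the leading unbounded quantifiers are
dualized and the fully bounded matrix is negated, e.g. `∀ x, ∃ y, ψ` becomes `∃ x, ∀ y, ¬ ψ`. -/
def reverse : {n : ℕ} → Fml L n → Fml L n
  | _, all φ => ex φ.reverse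
  | _, ex φ => all φ.reverse
  | _, φ => neg φ

variable [L.IsOrdered] {M : Type*} [L.Structure M]

/-- Truth of a formula in `M` when its unbounded quantifiers range over the set `D` only; the
bounded quantifiers are not affected by `D`. -/
def RealizeOn (D : Set M) : {n : ℕ} → Fml L n → (Fin n → M) → Prop
  | _, eq s t, v => s.realize v = t.realize v
  | _, rel R ts, v => FirstOrder.Language.Structure.RelMap R (fun i => (ts i).realize v)
  | _, neg φ, v => ¬ φ.RealizeOn D v
  | _, and φ ψ, v => φ.RealizeOn D v ∧ ψ.RealizeOn D v
  | _, or φ ψ, v => φ.RealizeOn D v ∨ ψ.RealizeOn D v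
  | _, imp φ ψ, v => φ.RealizeOn D v → ψ.RealizeOn D v
  | _, all φ, v => ∀ a ∈ D, φ.RealizeOn D (Fin.snoc (α := fun _ => M) v a)
  | _, ex φ, v => ∃ a ∈ D, φ.RealizeOn D (Fin.snoc (α := fun _ => M) v a)
  | _, ball t φ, v => ∀ a : M,
      FirstOrder.Language.Structure.RelMap (FirstOrder.Language.leSymb : L.Relations 2) ![a, t.realize v] →
        φ.RealizeOn D (Fin.snoc (α := fun _ => M) v a)
  | _, bex t φ, v => ∃ a : M,
      FirstOrder.Language.Structure.RelMap (FirstOrder.Language.leSymb : L.Relations 2) ![a, t.realize v] ∧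
        φ.RealizeOn D (Fin.snoc (α := fun _ => M) v a)

/-- Ordinary truth of a formula in the structure `M`. -/
def Realize {n : ℕ} (φ : Fml L n) (v : Fin n → M) : Prop := φ.RealizeOn Set.univ v

end Fml

/-- `φ` is a semantic consequence of `α`: it holds in all models of `α`. -/
def Entails {L : FirstOrder.Language.{0, 0}} [L.IsOrdered] (α : Set (Sent L)) (φ : Sent L) : Prop :=
  ∀ (M : Type) [L.Structure M] [Nonempty M],
    (∀ ψ ∈ α, Fml.Realize (M := M) ψ ![]) → Fml.Realize (M := M) φ ![]

/-! ## Deduction methods -/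

/-- A deduction method together with an encoding of its proofs by natural numbers.
`Derives p φ` says that `p` is the Gödel number of a correct derivation of `φ`, and `axiomsUsed p`
is the set of the proper axioms that the derivation `p` cites. -/
structure DeductionMethod (L : FirstOrder.Language.{u, v}) where
  Derives : ℕ → Sent L → Prop
  axiomsUsed : ℕ → Finset (Sent L)

namespace DeductionMethod

variable {L : FirstOrder.Language.{u, v}} (d : DeductionMethod L)

/-- `p` is (the Gödel number of) a proof of `φ` from the axiom system `α`. -/
def IsProof (α : Set (Sent L)) (p : ℕ) (φ : Sent L) : Prop :=
  d.Derives p φ ∧ ↑(d.axiomsUsed p) ⊆ α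

/-- `φ` is a theorem of `α`. -/
def Proves (α : Set (Sent L)) (φ : Sent L) : Prop := ∃ p, d.IsProof α p φ

/-- No sentence is proved together with its negation. -/
def Consistent (α : Set (Sent L)) : Prop := ¬ ∃ φ, d.Proves α φ ∧ d.Proves α φ.neg

end DeductionMethod

/-! ## `Δ₀` relations on the natural numbers -/

/-- The `Δ₀` relations on `ℕ` (equivalently: the relations in the linear-time hierarchy LinH, the
rudimentary relations, the constructive arithmetic relations): the least family of relations that
contains the graphs of addition and multiplication and the singletons, and is closed under Boolean
operations, permutation, identification and addition of variables, and bounded quantification. -/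
inductive IsLinH : (n : ℕ) → Set (Fin n → ℕ) → Prop
  | num (k : ℕ) : IsLinH 1 {w | w 0 = k}
  | add : IsLinH 3 {w | w 0 + w 1 = w 2}
  | mul : IsLinH 3 {w | w 0 * w 1 = w 2}
  | compl {n : ℕ} {R : Set (Fin n → ℕ)} : IsLinH n R → IsLinH n Rᶜ
  | inter {n : ℕ} {R S : Set (Fin n → ℕ)} : IsLinH n R → IsLinH n S → IsLinH n (R ∩ S)
  | comap {n m : ℕ} {R : Set (Fin n → ℕ)} (f : Fin n → Fin m) :
      IsLinH n R → IsLinH m {w | w ∘ f ∈ R}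
  | bex {n : ℕ} {R : Set (Fin (n + 1) → ℕ)} (i : Fin n) :
      IsLinH (n + 1) R → IsLinH n {w | ∃ a ≤ w i, Fin.snoc (α := fun _ => ℕ) w a ∈ R}

/-! ## Arithmetical languages and the classes `Δ₀`, `Πₙ`, `Σₙ` -/

/-- A language containing `0, 1, 2, =, ≤, max`, with its standard interpretation in `ℕ` (the
Standard-M model), in which every natural number `k` is the value of a closed term `T_k`. -/
structure ArithLanguage where
  L : FirstOrder.Language.{0, 0}
  ordered : L.IsOrdered
  standard : L.Structure ℕ
  zero : L.Constants
  one : L.Constants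
  two : L.Constants
  max : L.Functions 2
  numeral : ℕ → L.Term Empty
  zero_eq : (zero : ℕ) = 0
  one_eq : (one : ℕ) = 1
  two_eq : (two : ℕ) = 2
  max_eq : ∀ a b : ℕ, FirstOrder.Language.Structure.funMap max ![a, b] = Nat.max a b
  le_iff : ∀ a b : ℕ,
    FirstOrder.Language.Structure.RelMap (FirstOrder.Language.leSymb : L.Relations 2) ![a, b] ↔ a ≤ b
  numeral_eq : ∀ k : ℕ, (numeral k).realize (Empty.elim : Empty → ℕ) = k

attribute [instance] ArithLanguage.ordered ArithLanguage.standard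

namespace ArithLanguage

variable (A : ArithLanguage)

/-- The closed term `T_k`, viewed as a term in the variables `x₀, …, xₙ₋₁`. -/
def num {n : ℕ} (k : ℕ) : A.L.Term (Fin n) := (A.numeral k).relabel Empty.elim

/-- Truth of a sentence in the Standard-M model. -/
def Holds (φ : Sent A.L) : Prop := φ.Realize (![] : Fin 0 → ℕ)

/-- The formula `φ(x₀, …, xₙ₋₁)` defines the relation `R` in the Standard-M model. -/
def Defines {n : ℕ} (φ : Fml A.L n) (R : Set (Fin n → ℕ)) : Prop :=
  ∀ w : Fin n → ℕ, φ.Realize w ↔ w ∈ R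

end ArithLanguage

/-- A class `Δ₀` of fully bounded formulas: closed under the propositional connectives, under
quantifiers bounded by a variable, under substitution of variables and of numerals `T_k` for
variables, and containing definitions of the graphs of addition and multiplication. -/
structure BoundedClass (A : ArithLanguage) where
  mem : {n : ℕ} → Fml A.L n → Prop
  fullyBounded : ∀ {n : ℕ} {φ : Fml A.L n}, mem φ → φ.FullyBounded
  neg : ∀ {n : ℕ} {φ : Fml A.L n}, mem φ → mem φ.neg
  and : ∀ {n : ℕ} {φ ψ : Fml A.L n}, mem φ → mem ψ → mem (φ.and ψ)
  or : ∀ {n : ℕ} {φ ψ : Fml A.L n}, mem φ → mem ψ → mem (φ.or ψ)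
  imp : ∀ {n : ℕ} {φ ψ : Fml A.L n}, mem φ → mem ψ → mem (φ.imp ψ)
  ball : ∀ {n : ℕ} (i : Fin n) {φ : Fml A.L (n + 1)},
    mem φ → mem (Fml.ball (FirstOrder.Language.Term.var i) φ)
  bex : ∀ {n : ℕ} (i : Fin n) {φ : Fml A.L (n + 1)},
    mem φ → mem (Fml.bex (FirstOrder.Language.Term.var i) φ)
  subst : ∀ {n m : ℕ} {φ : Fml A.L n} (σ : Fin n → A.L.Term (Fin m)),
    (∀ i, (∃ j, σ i = FirstOrder.Language.Term.var j) ∨ ∃ k, σ i = A.num k) → mem φ → mem (φ.subst σ)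
  add : ∃ φ : Fml A.L 3, mem φ ∧ A.Defines φ {w | w 0 + w 1 = w 2}
  mul : ∃ φ : Fml A.L 3, mem φ ∧ A.Defines φ {w | w 0 * w 1 = w 2}

/-- The formulas `∀ v₁ ⋯ ∀ vₖ φ` with `φ` in the class `P` and `k ≥ 0`. -/
inductive AllBlock {L : FirstOrder.Language.{u, v}} (P : (n : ℕ) → Fml L n → Prop) :
    (n : ℕ) → Fml L n → Prop
  | base {n : ℕ} {φ : Fml L n} : P n φ → AllBlock P n φ
  | all {n : ℕ} {φ : Fml L (n + 1)} : AllBlock P (n + 1) φ → AllBlock P n φ.all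

/-- The formulas `∃ v₁ ⋯ ∃ vₖ φ` with `φ` in the class `P` and `k ≥ 0`. -/
inductive ExBlock {L : FirstOrder.Language.{u, v}} (P : (n : ℕ) → Fml L n → Prop) :
    (n : ℕ) → Fml L n → Prop
  | base {n : ℕ} {φ : Fml L n} : P n φ → ExBlock P n φ
  | ex {n : ℕ} {φ : Fml L (n + 1)} : ExBlock P (n + 1) φ → ExBlock P n φ.ex

namespace BoundedClass

variable {A : ArithLanguage} (Δ : BoundedClass A)

mutual

/-- The `Πₖ` formulas built from the class `Δ₀`. -/
def IsPi : ℕ → (n : ℕ) → Fml A.L n → Prop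
  | 0 => fun _ φ => Δ.mem φ
  | k + 1 => AllBlock (IsSigma k)

/-- The `Σₖ` formulas built from the class `Δ₀`. -/
def IsSigma : ℕ → (n : ℕ) → Fml A.L n → Prop
  | 0 => fun _ φ => Δ.mem φ
  | k + 1 => ExBlock (IsPi k)

end

end BoundedClass

/-! ## Generic configurations -/

/-- A generic configuration `ξ = (L, Δ₀, B, d, g)`. -/
structure GenericConfiguration where
  /-- the language and its standard model -/
  A : ArithLanguage
  /-- the class `Δ₀` of fully bounded formulas -/
  Δ : BoundedClass A
  /-- the base axiom system -/
  B : Set (Sent A.L)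
  /-- the deduction method, with its Gödel numbering of proofs -/
  d : DeductionMethod A.L
  /-- the Gödel numbering of formulas -/
  code : {n : ℕ} → Fml A.L n → ℕ
  /-- The base axioms are true in the Standard-M model. -/
  base_true : ∀ φ ∈ B, A.Holds φ
  /-- The base system is `Σ₁` complete. -/
  sigma_complete : ∀ φ : Sent A.L, Δ.IsSigma 1 0 φ → A.Holds φ → d.Proves B φ
  /-- For systems extending `B` (which may contain the equality axioms), the deduction method
  satisfies Gödel's completeness theorem. -/
  complete : ∀ (α : Set (Sent A.L)) (φ : Sent A.L), B ⊆ α → Entails α φ → d.Proves α φ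
  /-- The indirect implication property. -/
  indirect_implication : ∀ (α : Set (Sent A.L)) (X Y Z : Sent A.L), B ⊆ α →
    d.Proves α X → d.Proves α Y → d.Proves α ((X.and Y).imp Z) → d.Proves α Z
  /-- Distinct formulas have distinct Gödel numbers. -/
  code_injective :
    Function.Injective (fun φ : (Σ n : ℕ, Fml A.L n) => code φ.2)
  /-- The Gödel number of a proof is at least as large as those of the axioms it cites. -/
  code_axiom_le : ∀ (p : ℕ) (ψ : Sent A.L), ψ ∈ d.axiomsUsed p → code ψ ≤ p
  /-- The encoding is such that the elementary syntactical relations are `Δ₀` relations on `ℕ`: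
  being a `Π₁` sentence; being a `Πₖ` sentence and its negation (`k ≤ 1`); substitution of the
  numeral `T_k` in a formula with one free variable; being a base axiom; being a correct
  derivation; being an axiom cited in a derivation. -/
  linH_check : IsLinH 1 {w | ∃ φ : Sent A.L, Δ.IsPi 1 0 φ ∧ code φ = w 0}
  linH_neg : ∀ k ≤ 1,
    IsLinH 2 {w | ∃ φ : Sent A.L, Δ.IsPi k 0 φ ∧ code φ = w 0 ∧ code φ.reverse = w 1}
  linH_subst : IsLinH 3
    {w | ∃ γ : Fml A.L 1, code γ = w 0 ∧
      code (γ.subst (![A.num (w 1)] : Fin 1 → A.L.Term (Fin 0))) = w 2}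
  linH_base : IsLinH 1 {w | ∃ φ ∈ B, code φ = w 0}
  linH_derives : IsLinH 2 {w | ∃ φ : Sent A.L, code φ = w 0 ∧ d.Derives (w 1) φ}
  linH_axiomsUsed : IsLinH 2 {w | ∃ ψ ∈ d.axiomsUsed (w 1), code ψ = w 0}

namespace GenericConfiguration

variable (ξ : GenericConfiguration)

/-- Sentences of the language of `ξ`. -/
abbrev Sentence : Type := Sent ξ.A.L

/-- `Πₖ` sentences. -/
def PiSent (k : ℕ) (φ : ξ.Sentence) : Prop := ξ.Δ.IsPi k 0 φ

/-- `Σₖ` sentences. -/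
def SigmaSent (k : ℕ) (φ : ξ.Sentence) : Prop := ξ.Δ.IsSigma k 0 φ

/-! ### Good sentences and stability -/

/-- The set of natural numbers `< 2 ^ N`, for an extended real number `N`. -/
def below (N : EReal) : Set ℕ := {a | a = 0 ∧ N ≠ ⊥ ∨ a ≠ 0 ∧ ((Real.logb 2 a : ℝ) : EReal) < N}

/-- `Good(N)`: the sentence is true in the Standard-M model when its unbounded quantifiers are
bounded by `E(N) = 2 ^ N` (that is, `Scope_E(φ, N)` is true). -/
def Good (N : EReal) (φ : ξ.Sentence) : Prop := φ.RealizeOn (below N) (![] : Fin 0 → ℕ)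

/-- `♯ θ`: the largest integer `J` such that all sentences of `θ` are `Good(J)`, which is `⊤` if
there are arbitrarily large such `J`, and `⊥` if there is none. -/
noncomputable def sharp (θ : Set ξ.Sentence) : EReal :=
  sSup {N | ∃ J : ℕ, N = ((J : ℝ) : EReal) ∧ ∀ φ ∈ θ, ξ.Good N φ}

/-- R-views: recursively enumerable sets of `Π₁` sentences, not necessarily true ones. -/
def RView (θ : Set ξ.Sentence) : Prop :=
  (∀ φ ∈ θ, ξ.PiSent 1 φ) ∧ REPred (fun c : ℕ => ∃ φ ∈ θ, ξ.code φ = c)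

/-- The length of the binary coding of a Gödel number (with `Log 0 = 0`). -/
noncomputable def Log (p : ℕ) : ℝ := Real.logb 2 p

/-- A-stability. -/
def AStable : Prop :=
  ∀ θ, ξ.RView θ → ∀ φ p, ξ.PiSent 1 φ → ξ.d.IsProof (θ ∪ ξ.B) p φ →
    ((Log p : ℝ) : EReal) ≤ ξ.sharp θ + 1 → ξ.Good (ξ.sharp θ / 2) φ

/-- E-stability. -/
def EStable : Prop :=
  ∀ θ, ξ.RView θ → ∀ φ p, ξ.SigmaSent 1 φ → ξ.d.IsProof (θ ∪ ξ.B) p φ →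
    ((Log p : ℝ) : EReal) ≤ ξ.sharp θ + 1 → ξ.Good (((⌊Log p⌋ : ℝ) / 2 - 1 : ℝ) : EReal) φ

/-- EA-stability. -/
def EAStable : Prop := ξ.EStable ∧ ξ.AStable

/-- 0-stability. -/
def ZeroStable : Prop :=
  ∀ θ, ξ.RView θ → ∀ φ p, ξ.PiSent 0 φ → ξ.d.IsProof (θ ∪ ξ.B) p φ →
    ((Log p : ℝ) : EReal) ≤ ξ.sharp θ + 1 → ξ.A.Holds φ

/-! ### Level(k) consistency and self-justification -/

/-- `Level(k)` consistency: no `Πₖ` sentence is proved together with its `Σₖ` negation. -/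
def LevelConsistent (k : ℕ) (α : Set ξ.Sentence) : Prop :=
  ¬ ∃ φ, ξ.PiSent k φ ∧ ξ.d.Proves α φ ∧ ξ.d.Proves α φ.reverse

/-- `Negᵏ(x, y)`: `x` is a `Πₖ` sentence and `y` is the `Σₖ` sentence that is its negation. -/
def NegRel (k : ℕ) : Set (Fin 2 → ℕ) :=
  {w | ∃ φ, ξ.PiSent k φ ∧ ξ.code φ = w 0 ∧ ξ.code φ.reverse = w 1}

/-- `Prf_α(t, p)`: `p` is a proof of the sentence `t` from `α`. -/
def PrfRel (α : Set ξ.Sentence) : Set (Fin 2 → ℕ) :=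
  {w | ∃ φ, ξ.code φ = w 0 ∧ ξ.d.IsProof α (w 1) φ}

/-- `ExPrf_β(h, t, p)`: `p` is a proof of `t` from `β` together with the sentence `h`. -/
def ExPrf (β : Set ξ.Sentence) (h t p : ℕ) : Prop :=
  ∃ σ φ : ξ.Sentence, ξ.code σ = h ∧ ξ.code φ = t ∧ ξ.d.IsProof (β ∪ {σ}) p φ

/-- `Subst(g, h)`: `g` is a formula with one free variable, and `h` is the sentence obtained by
replacing this variable by the numeral of `g`. -/
def Subst (g h : ℕ) : Prop :=
  ∃ γ : Fml ξ.A.L 1, ξ.code γ = g ∧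
    ξ.code (γ.subst (![ξ.A.num g] : Fin 1 → ξ.A.L.Term (Fin 0))) = h

/-- `SubstPrf_β(g, t, p)`, that is `Prf_β(t, p) ∨ ∃ h ≤ p, Subst(g, h) ∧ ExPrf_β(h, t, p)`. -/
def SubstPrfRel (β : Set ξ.Sentence) : Set (Fin 3 → ℕ) :=
  {w | ![w 1, w 2] ∈ ξ.PrfRel β ∨ ∃ h ≤ w 2, ξ.Subst (w 0) h ∧ ξ.ExPrf β h (w 1) (w 2)}

/-- The formula `∀ x y p q, ¬ (ν(x, y) ∧ ρ(g, x, p) ∧ ρ(g, y, q))` with free variable `g`. -/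
def gammaFml (ν : Fml ξ.A.L 2) (ρ : Fml ξ.A.L 3) : Fml ξ.A.L 1 :=
  .all <| .all <| .all <| .all <| .neg <|
    .and (ν.subst ![FirstOrder.Language.Term.var (1 : Fin 5), FirstOrder.Language.Term.var 2]) <|
    .and (ρ.subst ![FirstOrder.Language.Term.var (0 : Fin 5), FirstOrder.Language.Term.var 1, FirstOrder.Language.Term.var 3])
      (ρ.subst ![FirstOrder.Language.Term.var (0 : Fin 5), FirstOrder.Language.Term.var 2, FirstOrder.Language.Term.var 4])

/-- `S` is a `SelfConsᵏ(β, d)` sentence: `S` is `Γ(T_n)`, where `n` is the Gödel number of the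
formula `Γ(g)`, namely `∀ x y p q, ¬ (Negᵏ(x, y) ∧ SubstPrf_β(g, x, p) ∧ SubstPrf_β(g, y, q))`,
written with `Δ₀` formulas for `Negᵏ` and `SubstPrf_β`. -/
def IsSelfCons (k : ℕ) (β : Set ξ.Sentence) (S : ξ.Sentence) : Prop :=
  ∃ (ν : Fml ξ.A.L 2) (ρ : Fml ξ.A.L 3),
    ξ.Δ.mem ν ∧ ξ.A.Defines ν (ξ.NegRel k) ∧
    ξ.Δ.mem ρ ∧ ξ.A.Defines ρ (ξ.SubstPrfRel β) ∧
    S = (ξ.gammaFml ν ρ).subst ![ξ.A.num (ξ.code (ξ.gammaFml ν ρ))]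

/-- The sentence `S` is a formal statement of the `Level(k)` consistency of `α`: it is
`∀ x y p q, ¬ (Negᵏ(x, y) ∧ Prf_α(x, p) ∧ Prf_α(y, q))`, written with `Δ₀` formulas that define
`Negᵏ` and `Prf_α` in the Standard-M model. -/
def StatesLevelConsistency (k : ℕ) (α : Set ξ.Sentence) (S : ξ.Sentence) : Prop :=
  ∃ ν π : Fml ξ.A.L 2,
    ξ.Δ.mem ν ∧ ξ.A.Defines ν (ξ.NegRel k) ∧ ξ.Δ.mem π ∧ ξ.A.Defines π (ξ.PrfRel α) ∧
    S = (.all <| .all <| .all <| .all <| .neg <|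
      .and (ν.subst ![FirstOrder.Language.Term.var (0 : Fin 4), FirstOrder.Language.Term.var 1]) <|
      .and (π.subst ![FirstOrder.Language.Term.var (0 : Fin 4), FirstOrder.Language.Term.var 2])
        (π.subst ![FirstOrder.Language.Term.var (1 : Fin 4), FirstOrder.Language.Term.var 3]))

/-- `α` is self-justifying and recognizes its own `Level(k)` consistency: one of its theorems
states the `Level(k)` consistency of `α`, and `α` is in fact consistent. -/
def SelfJustifying (k : ℕ) (α : Set ξ.Sentence) : Prop :=
  (∃ S, ξ.StatesLevelConsistency k α S ∧ ξ.d.Proves α S) ∧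
    ξ.LevelConsistent k α ∧ ξ.d.Consistent α

/-! ### Global simulation and braced sentences -/

/-- `TestList`: the `Δ₀` formulas `Test(t, x)` such that `Ψ ↔ ∀ x, Test(⌜Ψ⌝, x)` is true in the
Standard-M model for every `Π₁` sentence `Ψ`. -/
def TestList : Set (Fml ξ.A.L 2) :=
  {τ | ξ.Δ.mem τ ∧ ∀ Ψ : ξ.Sentence, ξ.PiSent 1 Ψ →
    (ξ.A.Holds Ψ ↔ ∀ x : ℕ, τ.Realize ![ξ.code Ψ, x])}

/-- `χ(t)` is a formula `Check(t)`: a `Δ₀` formula stating that `t` is a `Π₁` sentence. -/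
def IsCheck (χ : Fml ξ.A.L 1) : Prop :=
  ξ.Δ.mem χ ∧ ξ.A.Defines χ {w | ∃ φ, ξ.PiSent 1 φ ∧ ξ.code φ = w 0}

/-- `π(t, q)` is a formula `Prf_𝓑^D(t, q)`: a `Δ₀` formula stating that `q` is a proof of the
sentence `t` from the axiom system `𝓑`, in a language extending that of `ξ`, under the deduction
method `D`. -/
def IsPrfFormula {L' : FirstOrder.Language.{0, 0}} (ι : ξ.A.L →ᴸ L') (𝓑 : Set (Sent L'))
    (D : DeductionMethod L') (π : Fml ξ.A.L 2) : Prop :=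
  ξ.Δ.mem π ∧ ∀ (Ψ : ξ.Sentence) (q : ℕ),
    π.Realize ![ξ.code Ψ, q] ↔ D.IsProof 𝓑 q (Ψ.map ι)

/-- The sentence `∀ t q x, (Prf(t, q) ∧ Check(t)) → Test(t, x)`. -/
def globSim (π : Fml ξ.A.L 2) (χ : Fml ξ.A.L 1) (τ : Fml ξ.A.L 2) : ξ.Sentence :=
  .all <| .all <| .all <| .imp
    (.and (π.subst ![FirstOrder.Language.Term.var (0 : Fin 3), FirstOrder.Language.Term.var 1])
      (χ.subst ![FirstOrder.Language.Term.var (0 : Fin 3)]))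
    (τ.subst ![FirstOrder.Language.Term.var (0 : Fin 3), FirstOrder.Language.Term.var 2])

/-- `G` is a global simulation sentence `GlobSim` of `(𝓑, D)` for the test predicate `τ`. -/
def IsGlobSim {L' : FirstOrder.Language.{0, 0}} (ι : ξ.A.L →ᴸ L') (𝓑 : Set (Sent L'))
    (D : DeductionMethod L') (τ : Fml ξ.A.L 2) (G : ξ.Sentence) : Prop :=
  ∃ (π : Fml ξ.A.L 2) (χ : Fml ξ.A.L 1),
    ξ.IsPrfFormula ι 𝓑 D π ∧ ξ.IsCheck χ ∧ G = ξ.globSim π χ τ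

/-- `Ψ` is a `Braced(Φ, τ)` sentence: a `Π₁` sentence such that `B + Φ` proves
`(∀ x, Test(⌜Ψ⌝, x)) → Ψ`, where `Test` is `τ`. -/
def Braced (Φ : ξ.Sentence) (τ : Fml ξ.A.L 2) (Ψ : ξ.Sentence) : Prop :=
  ξ.PiSent 1 Ψ ∧ ξ.d.Proves (ξ.B ∪ {Φ})
    (.imp (.all (τ.subst ![ξ.A.num (ξ.code Ψ), FirstOrder.Language.Term.var (0 : Fin 1)])) Ψ)

end GenericConfiguration

end SelfJust

open SelfJust

-- The crux is that `S` is true, although it asserts the Level(k) consistency of a system that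
-- contains `S` itself. Suppose `S` is false and let `m` be the least common bound on a
-- counterexample `x, y, p, q`: codes of a sentence and its negation, with proofs of both from `B ∪
-- {Φ, G, S}`. With `J = ⌊log₂ m⌋`, minimality makes `S` Good(J), since no counterexample lies below
-- `2 ^ J ≤ m`; the true Π₁ sentences `Φ` and `G` are Good everywhere. So `♯{Φ, G, S} ≥ J`, while
-- both proofs are below `2 ^ (J + 1)`, which is within reach of stability. Stability, which is
-- postulated for untrue axioms too, then makes both a sentence and its negation true or
-- sufficiently Good, which is absurd (`not_isProof_reverse`, `IsSelfCons.holds`).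
--
-- Self-reference needs no fixed-point lemma inside `B`. By injectivity of the coding, and because a
-- proof's code bounds those of its axioms, `SubstPrf` at the code of `Γ` is provability from `β ∪
-- {S}` (`substPrfRel_iff`). Replacing the first argument of its formula by a numeral yields a
-- formula for `Prf` and a consistency statement that `S` entails logically. Existence of all the
-- formulas follows from definability of LinH relations in the class Δ₀ (`exists_defines`).
--
-- For the second property, `B` verifies the concrete fact that `q` proves `Ψ` by Σ₁ completeness,
-- `G` turns it into `∀ x, Test(⌜Ψ⌝, x)`, and bracedness yields `Ψ`.

namespace SelfJust

-- Relativised truth, substitution and reversal of formulas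

namespace Fml

open FirstOrder FirstOrder.Language

variable {L : FirstOrder.Language.{0, 0}}

theorem FullyBounded.reverse_eq {n : ℕ} {φ : Fml L n} (h : φ.FullyBounded) :
    φ.reverse = φ.neg := by
  cases φ <;> first | rfl | exact h.elim

variable {M : Type*} [L.Structure M]

theorem realize_liftSub {n m : ℕ} (σ : Fin n → L.Term (Fin m)) (v : Fin m → M) (a : M) :
    (fun i => (liftSub σ i).realize (Fin.snoc (α := fun _ => M) v a)) =
      Fin.snoc (α := fun _ => M) (fun i => (σ i).realize v) a := by
  funext i
  refine Fin.lastCases ?_ (fun i => ?_) i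
  · simp [liftSub]
  · simp only [liftSub, Fin.snoc_castSucc, Term.realize_relabel]
    congr 1
    funext j
    simp

variable [L.IsOrdered]

theorem realizeOn_subst (D : Set M) {n m : ℕ} (φ : Fml L n) (σ : Fin n → L.Term (Fin m))
    (v : Fin m → M) :
    (φ.subst σ).RealizeOn D v ↔ φ.RealizeOn D (fun i => (σ i).realize v) := by
  induction φ generalizing m with
  | eq s t => simp [subst, RealizeOn]
  | rel R ts => simp [subst, RealizeOn]
  | neg φ ih => simp [subst, RealizeOn, ih]
  | and φ ψ ih₁ ih₂ => simp [subst, RealizeOn, ih₁, ih₂]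
  | or φ ψ ih₁ ih₂ => simp [subst, RealizeOn, ih₁, ih₂]
  | imp φ ψ ih₁ ih₂ => simp [subst, RealizeOn, ih₁, ih₂]
  | all φ ih => simp [subst, RealizeOn, ih, realize_liftSub]
  | ex φ ih => simp [subst, RealizeOn, ih, realize_liftSub]
  | ball t φ ih => simp [subst, RealizeOn, ih, realize_liftSub]
  | bex t φ ih => simp [subst, RealizeOn, ih, realize_liftSub]

theorem realize_subst {n m : ℕ} (φ : Fml L n) (σ : Fin n → L.Term (Fin m)) (v : Fin m → M) :
    (φ.subst σ).Realize v ↔ φ.Realize (fun i => (σ i).realize v) :=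
  realizeOn_subst _ φ σ v

theorem FullyBounded.realizeOn_iff (D : Set M) {n : ℕ} {φ : Fml L n} (h : φ.FullyBounded)
    (v : Fin n → M) : φ.RealizeOn D v ↔ φ.Realize v := by
  unfold Realize
  induction φ with
  | eq s t => rfl
  | rel R ts => rfl
  | neg φ ih => simp [RealizeOn, ih h]
  | and φ ψ ih₁ ih₂ => simp [RealizeOn, ih₁ h.1, ih₂ h.2]
  | or φ ψ ih₁ ih₂ => simp [RealizeOn, ih₁ h.1, ih₂ h.2]
  | imp φ ψ ih₁ ih₂ => simp [RealizeOn, ih₁ h.1, ih₂ h.2]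
  | all φ ih => exact h.elim
  | ex φ ih => exact h.elim
  | ball t φ ih => simp [RealizeOn, ih h]
  | bex t φ ih => simp [RealizeOn, ih h]

theorem realizeOn_reverse (D : Set M) {n : ℕ} (φ : Fml L n) (v : Fin n → M) :
    φ.reverse.RealizeOn D v ↔ ¬ φ.RealizeOn D v := by
  induction φ with
  | all φ ih => simp [reverse, RealizeOn, ih]
  | ex φ ih => simp [reverse, RealizeOn, ih]
  | _ => rfl

end Fml

namespace DeductionMethod

theorem Proves.mono {L : FirstOrder.Language} {d : DeductionMethod L} {α β : Set (Sent L)}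
    {φ : Sent L} (h : α ⊆ β) : d.Proves α φ → d.Proves β φ :=
  fun ⟨p, hp, hs⟩ => ⟨p, hp, hs.trans h⟩

end DeductionMethod

/-- Shrinking the range of the universal quantifiers preserves truth, because the matrix does not
see the restriction. Applied to Π₁ sentences, it makes true ones Good at every level. -/
theorem AllBlock.realizeOn_anti {L : FirstOrder.Language.{0, 0}} [L.IsOrdered] {M : Type*}
    [L.Structure M] {P : (n : ℕ) → Fml L n → Prop}
    (hP : ∀ {n : ℕ} {φ : Fml L n}, P n φ → φ.FullyBounded) {D E : Set M} (hDE : D ⊆ E)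
    {n : ℕ} {φ : Fml L n} (h : AllBlock P n φ) (v : Fin n → M) :
    φ.RealizeOn E v → φ.RealizeOn D v := by
  induction h with
  | base h => exact fun hE => ((hP h).realizeOn_iff D v).2 (((hP h).realizeOn_iff E v).1 hE)
  | all h ih => exact fun hE a ha => ih _ (hE a (hDE ha))

theorem AllBlock.exBlock_reverse {L : FirstOrder.Language.{0, 0}}
    {P : (n : ℕ) → Fml L n → Prop} (hP : ∀ {n : ℕ} {φ : Fml L n}, P n φ → P n φ.reverse)
    {n : ℕ} {φ : Fml L n} (h : AllBlock P n φ) : ExBlock P n φ.reverse := by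
  induction h with
  | base h => exact .base (hP h)
  | all h ih => exact .ex ih

/-! ### `Δ₀` relations -/

namespace IsLinH

theorem of_iff {n : ℕ} {R S : Set (Fin n → ℕ)} (h : IsLinH n R) (hRS : ∀ w, w ∈ R ↔ w ∈ S) :
    IsLinH n S := Set.ext hRS ▸ h

theorem union {n : ℕ} {R S : Set (Fin n → ℕ)} (hR : IsLinH n R) (hS : IsLinH n S) :
    IsLinH n (R ∪ S) :=
  (hR.compl.inter hS.compl).compl.of_iff fun w => by simp [← not_or]

theorem ball {n : ℕ} {R : Set (Fin (n + 1) → ℕ)} (i : Fin n) (h : IsLinH (n + 1) R) :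
    IsLinH n {w | ∀ a ≤ w i, Fin.snoc (α := fun _ => ℕ) w a ∈ R} :=
  (h.compl.bex i).compl.of_iff fun w => by simp

theorem eq : IsLinH 2 {w | w 0 = w 1} := by
  -- Equality is not a generator of the family, so `w 0 = w 1` is expressed as `∃ a ≤ w 0, a = 0 ∧ w
  -- 0 + a = w 1`.
  refine (((num 0).comap ![(2 : Fin 3)]).inter (add.comap ![(0 : Fin 3), 2, 1])).bex 0
    |>.of_iff fun w => ?_
  have h₁ (a : ℕ) : Fin.snoc (α := fun _ => ℕ) w a 1 = w 1 := rfl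
  have h₂ (a : ℕ) : Fin.snoc (α := fun _ => ℕ) w a 2 = a := rfl
  simp [h₁, h₂]

end IsLinH

-- Numerals in arbitrary structures

namespace ArithLanguage

variable (A : ArithLanguage)

theorem relabel_num {n m : ℕ} (f : Fin n → Fin m) (k : ℕ) :
    (A.num k : A.L.Term (Fin n)).relabel f = A.num k := by
  simp only [num, FirstOrder.Language.Term.relabel_relabel]
  congr 1
  exact funext fun x => x.elim

/-- The value of the numeral `T_k` in a structure for the language. -/
def numVal (M : Type*) [A.L.Structure M] (k : ℕ) : M :=
  (A.numeral k).realize (Empty.elim : Empty → M)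

@[simp]
theorem realize_num {M : Type*} [A.L.Structure M] {n : ℕ} (k : ℕ) (v : Fin n → M) :
    (A.num k).realize v = A.numVal M k := by
  simp only [num, numVal, FirstOrder.Language.Term.realize_relabel]
  congr 1
  exact funext fun x => x.elim

@[simp]
theorem numVal_nat (k : ℕ) : A.numVal ℕ k = k := A.numeral_eq k

end ArithLanguage

-- Defining LinH relations by formulas of the class Δ₀

namespace BoundedClass

open FirstOrder.Language

variable {A : ArithLanguage} (Δ : BoundedClass A)

theorem subst_var {n m : ℕ} {φ : Fml A.L n} (f : Fin n → Fin m) (h : Δ.mem φ) :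
    Δ.mem (φ.subst fun i => Term.var (f i)) :=
  Δ.subst _ (fun i => .inl ⟨f i, rfl⟩) h

/-- The closure conditions on the class Δ₀ mirror the generation of LinH, so induction on the latter
builds the formula. -/
theorem exists_defines {n : ℕ} {R : Set (Fin n → ℕ)} (h : IsLinH n R) :
    ∃ φ : Fml A.L n, Δ.mem φ ∧ A.Defines φ R := by
  induction h with
  | num k =>
    obtain ⟨φ, hφ, hd⟩ := Δ.add
    -- The class is not assumed to contain equations; `x = k` is written as `x + 0 = k` through the
    -- graph of addition.
    refine ⟨φ.subst ![Term.var 0, A.num 0, A.num k], Δ.subst _ ?_ hφ, fun w => ?_⟩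
    · intro i
      fin_cases i
      exacts [.inl ⟨0, rfl⟩, .inr ⟨0, rfl⟩, .inr ⟨k, rfl⟩]
    · rw [Fml.realize_subst, hd]
      simp
  | add => exact Δ.add
  | mul => exact Δ.mul
  | compl _ ih =>
    obtain ⟨φ, hφ, hd⟩ := ih
    exact ⟨φ.neg, Δ.neg hφ, fun w => not_congr (hd w)⟩
  | inter _ _ ih₁ ih₂ =>
    obtain ⟨φ, hφ, hd⟩ := ih₁
    obtain ⟨ψ, hψ, he⟩ := ih₂
    exact ⟨φ.and ψ, Δ.and hφ hψ, fun w => and_congr (hd w) (he w)⟩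
  | comap f _ ih =>
    obtain ⟨φ, hφ, hd⟩ := ih
    exact ⟨_, Δ.subst_var f hφ, fun w => (Fml.realize_subst _ _ _).trans (hd _)⟩
  | bex i _ ih =>
    obtain ⟨φ, hφ, hd⟩ := ih
    refine ⟨_, Δ.bex i hφ, fun w => exists_congr fun a => and_congr ?_ (hd _)⟩
    simp [A.le_iff]

theorem reverse_mem {n : ℕ} {φ : Fml A.L n} (h : Δ.mem φ) : Δ.mem φ.reverse := by
  rw [(Δ.fullyBounded h).reverse_eq]
  exact Δ.neg h

theorem realizeOn_iff {M : Type*} [A.L.Structure M] {n : ℕ} {φ : Fml A.L n} (h : Δ.mem φ)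
    (D : Set M) (v : Fin n → M) : φ.RealizeOn D v ↔ φ.Realize v :=
  (Δ.fullyBounded h).realizeOn_iff D v

end BoundedClass


namespace GenericConfiguration

open FirstOrder.Language

variable (ξ : GenericConfiguration)

/-! ### Syntactic relations -/

variable {ξ} in
theorem code_inj {φ ψ : ξ.Sentence} (h : ξ.code φ = ξ.code ψ) : φ = ψ := by
  have := @ξ.code_injective ⟨0, φ⟩ ⟨0, ψ⟩ h
  simpa using this

variable {ξ} in
theorem PiSent.realizeOn_anti {φ : ξ.Sentence} (h : ξ.PiSent 1 φ) {D E : Set ℕ} (hDE : D ⊆ E) :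
    φ.RealizeOn E (![] : Fin 0 → ℕ) → φ.RealizeOn D (![] : Fin 0 → ℕ) :=
  AllBlock.realizeOn_anti (P := ξ.Δ.IsSigma 0) (fun h => ξ.Δ.fullyBounded h) hDE h _

variable {ξ} in
theorem PiSent.good {φ : ξ.Sentence} (h : ξ.PiSent 1 φ) (ht : ξ.A.Holds φ) (N : EReal) :
    ξ.Good N φ :=
  h.realizeOn_anti (Set.subset_univ _) ht

variable {ξ} in
theorem PiSent.sigmaSent_reverse {φ : ξ.Sentence} (h : ξ.PiSent 1 φ) :
    ξ.SigmaSent 1 φ.reverse :=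
  AllBlock.exBlock_reverse (P := ξ.Δ.IsSigma 0) (fun h => ξ.Δ.reverse_mem h) h

/-- The two sentences have opposite truth values in `ℕ`. -/
theorem reverse_ne (φ : ξ.Sentence) : φ.reverse ≠ φ := fun h => by
  have := Fml.realizeOn_reverse (M := ℕ) Set.univ φ ![]
  rw [h] at this
  tauto

theorem linH_codes (φ ψ : ξ.Sentence) :
    IsLinH 1 {w | ∃ χ ∈ ξ.B ∪ {φ, ψ}, ξ.code χ = w 0} := by
  refine (ξ.linH_base.union ((IsLinH.num (ξ.code φ)).union (IsLinH.num (ξ.code ψ)))).of_iff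
    fun w => ?_
  simp [or_and_right, exists_or, eq_comm (b := w 0)]
  rw [or_comm, or_assoc]

/-- An axiom cited in `p` has code at most `p`, so the inclusion of the cited axioms in `β` is a
bounded quantification, hence within LinH. -/
theorem isProof_iff (β : Set ξ.Sentence) (p : ℕ) (φ : ξ.Sentence) :
    ξ.d.IsProof β p φ ↔ ξ.d.Derives p φ ∧
      ∀ a ≤ p, (∃ ψ ∈ ξ.d.axiomsUsed p, ξ.code ψ = a) → ∃ χ ∈ β, ξ.code χ = a := by
  refine and_congr_right fun _ => ⟨?_, fun h ψ hψ => ?_⟩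
  · rintro h a - ⟨ψ, hψ, rfl⟩
    exact ⟨ψ, h hψ, rfl⟩
  · obtain ⟨χ, hχ, e⟩ := h _ (ξ.code_axiom_le p ψ hψ) ⟨ψ, hψ, rfl⟩
    exact code_inj e ▸ hχ

theorem linH_prfRel {β : Set ξ.Sentence} (hβ : IsLinH 1 {w | ∃ χ ∈ β, ξ.code χ = w 0}) :
    IsLinH 2 (ξ.PrfRel β) := by
  refine (ξ.linH_derives.inter (((ξ.linH_axiomsUsed.comap ![(2 : Fin 3), 1]).compl.union
    (hβ.comap ![(2 : Fin 3)])).ball 1)).of_iff fun w => ?_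
  have h₁ (a : ℕ) : Fin.snoc (α := fun _ => ℕ) w a 1 = w 1 := rfl
  have h₂ (a : ℕ) : Fin.snoc (α := fun _ => ℕ) w a 2 = a := rfl
  simp only [PrfRel, isProof_iff, Set.mem_ofPred_eq, Set.mem_inter_iff, Set.mem_union,
    Set.mem_compl_iff, Function.comp_apply, Matrix.cons_val, h₁, h₂, ← imp_iff_not_or]
  tauto

/-- This differs from `ExPrf` in not requiring `w 0` to code a sentence. In `SubstPrfRel` the
accompanying `Subst` clause supplies that. -/
theorem linH_exPrf {β : Set ξ.Sentence} (hβ : IsLinH 1 {w | ∃ χ ∈ β, ξ.code χ = w 0}) :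
    IsLinH 3 {w | ∃ φ, ξ.code φ = w 1 ∧ ξ.d.Derives (w 2) φ ∧
      ∀ a ≤ w 2, (∃ ψ ∈ ξ.d.axiomsUsed (w 2), ξ.code ψ = a) →
        (∃ χ ∈ β, ξ.code χ = a) ∨ a = w 0} := by
  refine ((ξ.linH_derives.comap ![(1 : Fin 3), 2]).inter
    (((ξ.linH_axiomsUsed.comap ![(3 : Fin 4), 2]).compl.union
    ((hβ.comap ![(3 : Fin 4)]).union (IsLinH.eq.comap ![(3 : Fin 4), 0]))).ball 2)).of_iff
    fun w => ?_
  have h₀ (a : ℕ) : Fin.snoc (α := fun _ => ℕ) w a 0 = w 0 := rfl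
  have h₂ (a : ℕ) : Fin.snoc (α := fun _ => ℕ) w a 2 = w 2 := rfl
  have h₃ (a : ℕ) : Fin.snoc (α := fun _ => ℕ) w a 3 = a := rfl
  simp only [Set.mem_ofPred_eq, Set.mem_inter_iff, Set.mem_union,
    Set.mem_compl_iff, Function.comp_apply, Matrix.cons_val, h₀, h₂, h₃, ← imp_iff_not_or]
  tauto

theorem exPrf_code_iff (β : Set ξ.Sentence) (σ : ξ.Sentence) (t p : ℕ) :
    ξ.ExPrf β (ξ.code σ) t p ↔ ∃ φ, ξ.code φ = t ∧ ξ.d.IsProof (β ∪ {σ}) p φ :=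
  ⟨fun ⟨_, φ, h, ht, hp⟩ => ⟨φ, ht, code_inj h ▸ hp⟩, fun ⟨φ, ht, hp⟩ => ⟨σ, φ, rfl, ht, hp⟩⟩

theorem linH_substPrfRel {β : Set ξ.Sentence}
    (hβ : IsLinH 1 {w | ∃ χ ∈ β, ξ.code χ = w 0}) : IsLinH 3 (ξ.SubstPrfRel β) := by
  refine (((ξ.linH_prfRel hβ).comap ![(1 : Fin 3), 2]).union
    (((ξ.linH_subst.comap ![(0 : Fin 4), 0, 3]).inter
      ((ξ.linH_exPrf hβ).comap ![(3 : Fin 4), 1, 2])).bex 2)).of_iff fun w => ?_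
  have h₀ (a : ℕ) : Fin.snoc (α := fun _ => ℕ) w a 0 = w 0 := rfl
  have h₁ (a : ℕ) : Fin.snoc (α := fun _ => ℕ) w a 1 = w 1 := rfl
  have h₂ (a : ℕ) : Fin.snoc (α := fun _ => ℕ) w a 2 = w 2 := rfl
  have h₃ (a : ℕ) : Fin.snoc (α := fun _ => ℕ) w a 3 = a := rfl
  have e : w ∘ ![(1 : Fin 3), 2] = ![w 1, w 2] := by
    ext i; fin_cases i <;> rfl
  simp only [SubstPrfRel, Set.mem_union, Set.mem_ofPred_eq, e, Set.mem_inter_iff,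
    Function.comp_apply, Matrix.cons_val, h₀, h₁, h₂, h₃]
  refine or_congr_right (exists_congr fun h => and_congr_right fun _ =>
    and_congr_right fun ⟨γ, _, hγ⟩ => ?_)
  rw [← hγ, exPrf_code_iff]
  simp only [isProof_iff, Set.mem_union, Set.mem_singleton_iff, or_and_right, exists_or,
    exists_eq_left, eq_comm (b := ξ.code (γ.subst _))]

/-- Self-reference: for `γ` with diagonal instance `σ`, provability with the axiom described by
`γ` is provability from `β ∪ {σ}`. -/
theorem substPrfRel_iff (β : Set ξ.Sentence) (γ : Fml ξ.A.L 1) (t p : ℕ) :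
    ![ξ.code γ, t, p] ∈ ξ.SubstPrfRel β ↔
      ![t, p] ∈ ξ.PrfRel (β ∪ {γ.subst ![ξ.A.num (ξ.code γ)]}) := by
  have hγ (h : ℕ) :
      ξ.Subst (ξ.code γ) h ↔ ξ.code (γ.subst ![(ξ.A.num (ξ.code γ) : ξ.A.L.Term (Fin 0))]) = h := by
    refine ⟨fun ⟨γ', e, h'⟩ => ?_, fun h => ⟨γ, rfl, h⟩⟩
    have := @ξ.code_injective ⟨1, γ'⟩ ⟨1, γ⟩ e
    obtain rfl : γ' = γ := by simpa using this
    exact h'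
  simp only [SubstPrfRel, Set.mem_ofPred_eq, Matrix.cons_val, hγ, PrfRel]
  constructor
  · rintro (⟨φ, ht, hp, hs⟩ | ⟨h, -, rfl, hex⟩)
    · exact ⟨φ, ht, hp, hs.trans Set.subset_union_left⟩
    · exact (ξ.exPrf_code_iff _ _ _ _).1 hex
  · rintro ⟨φ, ht, hp, hs⟩
    -- The bound `h ≤ p` loses nothing: if the code of the diagonal sentence exceeds `p`, the proof
    -- cannot cite it and is a proof from `β` alone.
    by_cases hle : ξ.code (γ.subst ![(ξ.A.num (ξ.code γ) : ξ.A.L.Term (Fin 0))]) ≤ p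
    · exact .inr ⟨_, hle, rfl, (ξ.exPrf_code_iff _ _ _ _).2 ⟨φ, ht, hp, hs⟩⟩
    · refine .inl ⟨φ, ht, hp, fun ψ hψ => (hs hψ).resolve_right ?_⟩
      rintro rfl
      exact hle (ξ.code_axiom_le p _ hψ)

/-! ### The sentences `SelfCons` and `GlobSim` -/

/-- Δ₀ is closed only under substitution of variables and numerals; this property must survive the
passage under the four quantifiers of `Γ`. -/
theorem liftSub_var_or_num {n m : ℕ} {σ : Fin n → ξ.A.L.Term (Fin m)}
    (h : ∀ i, (∃ j, σ i = Term.var j) ∨ ∃ k, σ i = ξ.A.num k) (i : Fin (n + 1)) :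
    (∃ j, Fml.liftSub σ i = Term.var j) ∨ ∃ k, Fml.liftSub σ i = ξ.A.num k := by
  refine Fin.lastCases (.inl ⟨Fin.last m, by simp [Fml.liftSub]⟩) (fun i => ?_) i
  simp only [Fml.liftSub, Fin.snoc_castSucc]
  rcases h i with ⟨j, hj⟩ | ⟨k, hk⟩
  · exact .inl ⟨j.castSucc, by rw [hj]; rfl⟩
  · exact .inr ⟨k, by rw [hk, ξ.A.relabel_num]⟩

theorem mem_subst_pair {m : ℕ} {ν : Fml ξ.A.L 2} (hν : ξ.Δ.mem ν) (i j : Fin m) :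
    ξ.Δ.mem (ν.subst ![Term.var i, Term.var j]) :=
  ξ.Δ.subst _ (fun a => by fin_cases a; exacts [.inl ⟨i, rfl⟩, .inl ⟨j, rfl⟩]) hν

theorem mem_subst_triple {m : ℕ} {ρ : Fml ξ.A.L 3} (hρ : ξ.Δ.mem ρ) (i j k : Fin m) :
    ξ.Δ.mem (ρ.subst ![Term.var i, Term.var j, Term.var k]) :=
  ξ.Δ.subst _
    (fun a => by fin_cases a; exacts [.inl ⟨i, rfl⟩, .inl ⟨j, rfl⟩, .inl ⟨k, rfl⟩]) hρ

theorem piSent_gammaFml_subst {ν : Fml ξ.A.L 2} {ρ : Fml ξ.A.L 3} (hν : ξ.Δ.mem ν)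
    (hρ : ξ.Δ.mem ρ) (k : ℕ) : ξ.PiSent 1 ((ξ.gammaFml ν ρ).subst ![ξ.A.num k]) := by
  have hσ : ∀ i : Fin 1, (∃ j, (![ξ.A.num k] : Fin 1 → ξ.A.L.Term (Fin 0)) i = Term.var j) ∨
      ∃ l, (![ξ.A.num k] : Fin 1 → ξ.A.L.Term (Fin 0)) i = ξ.A.num l := fun i => by
    fin_cases i
    exact .inr ⟨k, rfl⟩
  have hσ' := ξ.liftSub_var_or_num (ξ.liftSub_var_or_num (ξ.liftSub_var_or_num
    (ξ.liftSub_var_or_num hσ)))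
  exact .all <| .all <| .all <| .all <| .base <| ξ.Δ.neg <|
    ξ.Δ.and (ξ.Δ.subst _ hσ' (ξ.mem_subst_pair hν _ _)) <|
    ξ.Δ.and (ξ.Δ.subst _ hσ' (ξ.mem_subst_triple hρ _ _ _))
      (ξ.Δ.subst _ hσ' (ξ.mem_subst_triple hρ _ _ _))

theorem piSent_globSim {π τ : Fml ξ.A.L 2} {χ : Fml ξ.A.L 1} (hπ : ξ.Δ.mem π)
    (hχ : ξ.Δ.mem χ) (hτ : ξ.Δ.mem τ) : ξ.PiSent 1 (ξ.globSim π χ τ) :=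
  .all <| .all <| .all <| .base <| ξ.Δ.imp
    (ξ.Δ.and (ξ.mem_subst_pair hπ _ _)
      (ξ.Δ.subst _ (fun a => by fin_cases a; exact .inl ⟨0, rfl⟩) hχ))
    (ξ.mem_subst_pair hτ _ _)

theorem realizeOn_subst_single {M : Type*} [ξ.A.L.Structure M] (D : Set M) {m : ℕ}
    (ν : Fml ξ.A.L 1) (s : ξ.A.L.Term (Fin m)) (v : Fin m → M) :
    (ν.subst ![s]).RealizeOn D v ↔ ν.RealizeOn D ![s.realize v] := by
  rw [Fml.realizeOn_subst]
  congr! 1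
  funext i
  fin_cases i
  rfl

theorem realizeOn_subst_pair {M : Type*} [ξ.A.L.Structure M] (D : Set M) {m : ℕ}
    (ν : Fml ξ.A.L 2) (s t : ξ.A.L.Term (Fin m)) (v : Fin m → M) :
    (ν.subst ![s, t]).RealizeOn D v ↔ ν.RealizeOn D ![s.realize v, t.realize v] := by
  rw [Fml.realizeOn_subst]
  congr! 1
  funext i
  fin_cases i <;> rfl

theorem realizeOn_subst_triple {M : Type*} [ξ.A.L.Structure M] (D : Set M) {m : ℕ}
    (ν : Fml ξ.A.L 3) (s t u : ξ.A.L.Term (Fin m)) (v : Fin m → M) :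
    (ν.subst ![s, t, u]).RealizeOn D v ↔
      ν.RealizeOn D ![s.realize v, t.realize v, u.realize v] := by
  rw [Fml.realizeOn_subst]
  congr! 1
  funext i
  fin_cases i <;> rfl

theorem realizeOn_gammaFml_subst {M : Type*} [ξ.A.L.Structure M] (D : Set M)
    (ν : Fml ξ.A.L 2) (ρ : Fml ξ.A.L 3) (k : ℕ) :
    ((ξ.gammaFml ν ρ).subst ![ξ.A.num k]).RealizeOn D (![] : Fin 0 → M) ↔
      ∀ x ∈ D, ∀ y ∈ D, ∀ p ∈ D, ∀ q ∈ D, ¬ (ν.RealizeOn D ![x, y] ∧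
        ρ.RealizeOn D ![ξ.A.numVal M k, x, p] ∧ ρ.RealizeOn D ![ξ.A.numVal M k, y, q]) := by
  simp only [realizeOn_subst_single, gammaFml, Fml.RealizeOn, realizeOn_subst_pair,
    realizeOn_subst_triple, ξ.A.realize_num]
  rfl

theorem realize_globSim {M : Type*} [ξ.A.L.Structure M] (π τ : Fml ξ.A.L 2)
    (χ : Fml ξ.A.L 1) :
    (ξ.globSim π χ τ).Realize (![] : Fin 0 → M) ↔
      ∀ t q x : M, π.Realize ![t, q] ∧ χ.Realize ![t] → τ.Realize ![t, x] := by
  simp only [globSim, Fml.Realize, realizeOn_subst_single, Fml.RealizeOn, realizeOn_subst_pair,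
    Set.mem_univ, true_imp_iff]
  rfl

theorem exists_isCheck : ∃ χ, ξ.IsCheck χ := ξ.Δ.exists_defines ξ.linH_check

theorem exists_isSelfCons {k : ℕ} (hk : k ≤ 1) (φ ψ : ξ.Sentence) :
    ∃ S, ξ.IsSelfCons k (ξ.B ∪ {φ, ψ}) S := by
  obtain ⟨ν, hν, hν'⟩ := ξ.Δ.exists_defines (ξ.linH_neg k hk)
  obtain ⟨ρ, hρ, hρ'⟩ := ξ.Δ.exists_defines (ξ.linH_substPrfRel (ξ.linH_codes φ ψ))
  exact ⟨_, ν, ρ, hν, hν', hρ, hρ', rfl⟩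

variable {ξ} in
theorem IsSelfCons.piSent {k : ℕ} {β : Set ξ.Sentence} {S : ξ.Sentence}
    (h : ξ.IsSelfCons k β S) : ξ.PiSent 1 S := by
  obtain ⟨ν, ρ, hν, -, hρ, -, rfl⟩ := h
  exact ξ.piSent_gammaFml_subst hν hρ _

-- The diagonal sentence really speaks of proofs from `β ∪ {S}`. The set `D` stays arbitrary because
-- the relation is needed twice: with `D = below J` for goodness of `S`, and with `D` everything for
-- its truth.
variable {ξ} in
theorem IsSelfCons.realizeOn_iff {k : ℕ} {β : Set ξ.Sentence} {S : ξ.Sentence}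
    (h : ξ.IsSelfCons k β S) (D : Set ℕ) :
    S.RealizeOn D (![] : Fin 0 → ℕ) ↔ ∀ x ∈ D, ∀ y ∈ D, ∀ p ∈ D, ∀ q ∈ D,
      ¬ (![x, y] ∈ ξ.NegRel k ∧ ![x, p] ∈ ξ.PrfRel (β ∪ {S}) ∧
        ![y, q] ∈ ξ.PrfRel (β ∪ {S})) := by
  obtain ⟨ν, ρ, hν, hν', hρ, hρ', rfl⟩ := h
  simp only [realizeOn_gammaFml_subst, ξ.Δ.realizeOn_iff hν, ξ.Δ.realizeOn_iff hρ, hν' _, hρ' _,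
    ξ.A.numVal_nat, substPrfRel_iff]

-- Fixing the first argument of the formula for `SubstPrf` at the numeral of `Γ` gives a Δ₀ formula
-- for `Prf`. The consistency statement built from it holds in exactly the same structures as `S`,
-- so no arithmetic is needed for the entailment.
variable {ξ} in
theorem IsSelfCons.exists_statesLevelConsistency {k : ℕ} {β : Set ξ.Sentence} {S : ξ.Sentence}
    (h : ξ.IsSelfCons k β S) :
    ∃ S', ξ.StatesLevelConsistency k (β ∪ {S}) S' ∧ Entails {S} S' := by
  obtain ⟨ν, ρ, hν, hν', hρ, hρ', rfl⟩ := h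
  set n := ξ.code (ξ.gammaFml ν ρ) with hn
  refine ⟨_, ⟨ν, ρ.subst ![ξ.A.num n, Term.var 0, Term.var 1], hν, hν',
    ξ.Δ.subst _ (fun a => ?_) hρ, fun w => ?_, rfl⟩, fun M _ _ hM => ?_⟩
  · fin_cases a
    exacts [.inr ⟨n, rfl⟩, .inl ⟨0, rfl⟩, .inl ⟨1, rfl⟩]
  · have hw : w = ![w 0, w 1] := by ext i; fin_cases i <;> rfl
    rw [Fml.Realize, realizeOn_subst_triple, ← Fml.Realize, hρ' _]
    conv_rhs => rw [hw, ← substPrfRel_iff]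
    simp [← hn]
  · have := (ξ.realizeOn_gammaFml_subst Set.univ ν ρ n).1 (hM _ rfl)
    simp only [Fml.Realize, Fml.RealizeOn, realizeOn_subst_pair, realizeOn_subst_triple,
      ξ.A.realize_num]
    exact this

/-! ### Consequences of stability -/

theorem below_mono {M N : EReal} (h : M ≤ N) : below M ⊆ below N := by
  rintro a (⟨h₀, hM⟩ | ⟨h₀, hM⟩)
  · exact .inl ⟨h₀, ne_bot_of_le_ne_bot hM h⟩
  · exact .inr ⟨h₀, hM.trans_le h⟩

theorem lt_of_mem_below {a J : ℕ} (h : a ∈ below ((J : ℝ) : EReal)) : a < 2 ^ J := by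
  rcases h with ⟨rfl, -⟩ | ⟨h₀, h⟩
  · positivity
  · rw [EReal.coe_lt_coe_iff, Real.logb_lt_iff_lt_rpow (by norm_num) (by positivity),
      Real.rpow_natCast] at h
    exact_mod_cast h

theorem Log_lt {p J : ℕ} (h : p < 2 ^ (J + 1)) : Log p < J + 1 := by
  rcases Nat.eq_zero_or_pos p with rfl | hp
  · simp [Log]; positivity
  · rw [Log, Real.logb_lt_iff_lt_rpow (by norm_num) (by positivity)]
    exact_mod_cast h

/-- Stable configurations admit no short contradictory pair of proofs. -/
theorem not_isProof_reverse {k : ℕ}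
    (hk : k = 1 ∧ ξ.EAStable ∨ k = 0 ∧ (ξ.EStable ∨ ξ.AStable ∨ ξ.ZeroStable))
    {θ : Set ξ.Sentence} (hθ : ξ.RView θ) {φ : ξ.Sentence} (hφ : ξ.PiSent k φ) {p q : ℕ}
    (hp : ((Log p : ℝ) : EReal) ≤ ξ.sharp θ + 1) (hq : ((Log q : ℝ) : EReal) ≤ ξ.sharp θ + 1)
    (hq' : (((⌊Log q⌋ : ℝ)) : EReal) ≤ ξ.sharp θ) (hpφ : ξ.d.IsProof (θ ∪ ξ.B) p φ) :
    ¬ ξ.d.IsProof (θ ∪ ξ.B) q φ.reverse := by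
  intro hqφ
  rcases hk with ⟨rfl, hE, hA⟩ | ⟨rfl, hst⟩
  · have h₁ := hA θ hθ φ p hφ hpφ hp
    have h₂ := hE θ hθ _ q hφ.sigmaSent_reverse hqφ hq
    -- The negation is Good at `⌊Log q⌋/2 - 1`, which is at most `♯θ/2`. The Π₁ sentence, Good at
    -- `♯θ/2`, is therefore Good at that lower level too, and the two clash there.
    refine (Fml.realizeOn_reverse _ _ _).1 h₂ (hφ.realizeOn_anti (below_mono ?_) h₁)
    calc (((⌊Log q⌋ : ℝ) / 2 - 1 : ℝ) : EReal) ≤ (((⌊Log q⌋ : ℝ) / 2 : ℝ) : EReal) :=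
          EReal.coe_le_coe_iff.2 (by linarith)
      _ = (((⌊Log q⌋ : ℝ)) : EReal) / 2 := by rw [EReal.coe_div]; rfl
      _ ≤ ξ.sharp θ / 2 := EReal.div_le_div_right_of_nonneg (by norm_num) hq'
  · have hφ' : ξ.PiSent 0 φ.reverse := ξ.Δ.reverse_mem hφ
    suffices h : ξ.A.Holds φ ∧ ξ.A.Holds φ.reverse from
      (Fml.realizeOn_reverse _ _ _).1 h.2 h.1
    -- A Δ₀ sentence is a Π₁ and a Σ₁ sentence with empty quantifier block, and its goodness at any
    -- level is plain truth; so each stability notion alone makes both sentences true.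
    rcases hst with hE | hA | h0
    · exact ⟨(ξ.Δ.realizeOn_iff hφ _ _).1 (hE θ hθ φ p (.base hφ) hpφ hp),
        (ξ.Δ.realizeOn_iff hφ' _ _).1 (hE θ hθ _ q (.base hφ') hqφ hq)⟩
    · exact ⟨(ξ.Δ.realizeOn_iff hφ _ _).1 (hA θ hθ φ p (.base hφ) hpφ hp),
        (ξ.Δ.realizeOn_iff hφ' _ _).1 (hA θ hθ _ q (.base hφ') hqφ hq)⟩
    · exact ⟨h0 θ hθ φ p hφ hpφ hp, h0 θ hθ _ q hφ' hqφ hq⟩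

theorem rView_triple {φ ψ χ : ξ.Sentence} (hφ : ξ.PiSent 1 φ) (hψ : ξ.PiSent 1 ψ)
    (hχ : ξ.PiSent 1 χ) : ξ.RView {φ, ψ, χ} := by
  refine ⟨by rintro _ (rfl | rfl | rfl) <;> assumption, ?_⟩
  have h (a : ℕ) : PrimrecPred fun c : ℕ => c = a := Primrec.eq.comp .id (.const a)
  refine (((h (ξ.code φ)).or ((h (ξ.code ψ)).or (h (ξ.code χ)))).computablePred.to_re).of_eq
    fun c => ?_
  simp [eq_comm (a := c)]

variable {ξ} in
theorem IsSelfCons.holds {k : ℕ}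
    (hk : k = 1 ∧ ξ.EAStable ∨ k = 0 ∧ (ξ.EStable ∨ ξ.AStable ∨ ξ.ZeroStable))
    {φ ψ S : ξ.Sentence} (hφ : ξ.PiSent 1 φ) (hφt : ξ.A.Holds φ) (hψ : ξ.PiSent 1 ψ)
    (hψt : ξ.A.Holds ψ) (h : ξ.IsSelfCons k (ξ.B ∪ {φ, ψ}) S) : ξ.A.Holds S := by
  have hαθ : ξ.B ∪ {φ, ψ} ∪ {S} = {φ, ψ, S} ∪ ξ.B := by
    ext; simp; tauto
  by_contra hS
  rw [ArithLanguage.Holds, Fml.Realize, h.realizeOn_iff] at hS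
  -- A single bound `m` on all four numbers is what gets minimised, so that excluding smaller
  -- counterexamples is a statement about an initial segment of `ℕ`.
  have hex : ∃ m, ∃ x ≤ m, ∃ y ≤ m, ∃ p ≤ m, ∃ q ≤ m, ![x, y] ∈ ξ.NegRel k ∧
      ![x, p] ∈ ξ.PrfRel (ξ.B ∪ {φ, ψ} ∪ {S}) ∧
      ![y, q] ∈ ξ.PrfRel (ξ.B ∪ {φ, ψ} ∪ {S}) := by
    push Not at hS
    obtain ⟨x, -, y, -, p, -, q, -, hx⟩ := hS
    exact ⟨x + y + p + q, x, by omega, y, by omega, p, by omega, q, by omega, hx⟩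
  classical
  set m := Nat.find hex with hm
  obtain ⟨x, hx, y, hy, p, hp, q, hq, ⟨χ, hχ, hχx, hχy⟩, ⟨_, h₁, hpχ⟩, _, h₂, hqχ⟩ :=
    Nat.find_spec hex
  simp only [Matrix.cons_val] at hχx hχy h₁ h₂ hpχ hqχ
  obtain rfl := code_inj (hχx.trans h₁.symm)
  obtain rfl := code_inj (hχy.trans h₂.symm)
  rw [← hm] at hx hy hp hq
  -- If `m = 0`, the sentence and its negation would share the code `0`. Nonzero `m` is needed for
  -- `2 ^ J ≤ m` and for `m - 1 < m`.
  have hm₀ : m ≠ 0 := fun h₀ =>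
    ξ.reverse_ne χ (code_inj (by omega))
  have hlow := Nat.pow_log_le_self 2 hm₀
  have hupp := Nat.lt_pow_succ_log_self (b := 2) (by norm_num) m
  set J := Nat.log 2 m
  have hSgood : ξ.Good ((J : ℝ) : EReal) S := by
    refine (h.realizeOn_iff _).2 fun x' hx' y' hy' p' hp' q' hq' hbad => ?_
    have hx'' := lt_of_mem_below hx'
    have hy'' := lt_of_mem_below hy'
    have hp'' := lt_of_mem_below hp'
    have hq'' := lt_of_mem_below hq'
    -- Numbers below `2 ^ J ≤ m` are at most `m - 1`.
    exact Nat.find_min hex (m := m - 1) (by omega)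
      ⟨x', by omega, y', by omega, p', by omega, q', by omega, hbad⟩
  have hJ : ((J : ℝ) : EReal) ≤ ξ.sharp {φ, ψ, S} := by
    refine le_sSup ⟨J, rfl, ?_⟩
    rintro _ (rfl | rfl | rfl)
    exacts [hφ.good hφt _, hψ.good hψt _, hSgood]
  -- The `+ 1` in the stability hypothesis absorbs the rounding in `J = ⌊log₂ m⌋`.
  have hLog {r : ℕ} (hr : r ≤ m) : ((Log r : ℝ) : EReal) ≤ ξ.sharp {φ, ψ, S} + 1 :=
    calc ((Log r : ℝ) : EReal) ≤ ((J + 1 : ℝ) : EReal) :=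
          EReal.coe_le_coe_iff.2 (Log_lt (hr.trans_lt hupp)).le
      _ = ((J : ℝ) : EReal) + 1 := by rw [EReal.coe_add]; rfl
      _ ≤ _ := add_le_add_left hJ 1
  refine ξ.not_isProof_reverse hk (ξ.rView_triple hφ hψ h.piSent) hχ (hLog hp) (hLog hq)
    (le_trans (EReal.coe_le_coe_iff.2 ?_) hJ) (hαθ ▸ hpχ) (hαθ ▸ hqχ)
  have : ⌊Log q⌋ < (J : ℤ) + 1 :=
    Int.floor_lt.2 (by exact_mod_cast Log_lt (hq.trans_lt hupp))
  exact_mod_cast Int.lt_add_one_iff.1 this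

-- Level consistency, consistency and derivations in `d`

theorem levelConsistent_iff (k : ℕ) (α : Set ξ.Sentence) :
    ξ.LevelConsistent k α ↔ ∀ x y p q,
      ¬ (![x, y] ∈ ξ.NegRel k ∧ ![x, p] ∈ ξ.PrfRel α ∧ ![y, q] ∈ ξ.PrfRel α) := by
  constructor
  · rintro h x y p q ⟨⟨χ, hχ, hχx, hχy⟩, ⟨_, h₁, hpχ⟩, _, h₂, hqχ⟩
    simp only [Matrix.cons_val] at hχx hχy h₁ h₂ hpχ hqχ
    obtain rfl := code_inj (hχx.trans h₁.symm)
    obtain rfl := code_inj (hχy.trans h₂.symm)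
    exact h ⟨χ, hχ, ⟨p, hpχ⟩, q, hqχ⟩
  · rintro h ⟨χ, hχ, ⟨p, hp⟩, q, hq⟩
    exact h _ _ p q ⟨⟨χ, hχ, rfl, rfl⟩, ⟨χ, rfl, hp⟩, _, rfl, hq⟩

-- An inconsistent system proves everything, in particular some Δ₀ sentence and its negation. The
-- instance of the addition formula at zeros serves only as such a sentence.
variable {ξ} in
theorem LevelConsistent.consistent {k : ℕ} (hk : k ≤ 1) {α : Set ξ.Sentence} (hα : ξ.B ⊆ α)
    (h : ξ.LevelConsistent k α) : ξ.d.Consistent α := by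
  rintro ⟨φ, hφ, hφ'⟩
  have hall (ψ : ξ.Sentence) : ξ.d.Proves α ψ :=
    ξ.indirect_implication α φ φ.neg ψ hα hφ hφ'
      (ξ.complete α _ hα fun M _ _ _ hc => absurd hc.1 hc.2)
  obtain ⟨ψ, hψ, -⟩ := ξ.Δ.add
  have hψ₀ : ξ.Δ.mem (ψ.subst fun _ => (ξ.A.num 0 : ξ.A.L.Term (Fin 0))) :=
    ξ.Δ.subst _ (fun _ => .inr ⟨0, rfl⟩) hψ
  have hψ₁ : ξ.PiSent k (ψ.subst fun _ => (ξ.A.num 0 : ξ.A.L.Term (Fin 0))) := by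
    interval_cases k
    exacts [hψ₀, .base hψ₀]
  exact h ⟨_, hψ₁, hall _, hall _⟩

/-- Modus ponens, obtained from the indirect implication property. -/
theorem proves_of_imp {α : Set ξ.Sentence} (hα : ξ.B ⊆ α) {φ ψ : ξ.Sentence}
    (h : ξ.d.Proves α (φ.imp ψ)) (hφ : ξ.d.Proves α φ) : ξ.d.Proves α ψ :=
  ξ.indirect_implication α _ _ ψ hα h hφ (ξ.complete α _ hα fun _ _ _ _ hc => hc.1 hc.2)

theorem proves_of_mem {α : Set ξ.Sentence} (hα : ξ.B ⊆ α) {φ : ξ.Sentence} (h : φ ∈ α) :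
    ξ.d.Proves α φ :=
  ξ.complete α φ hα fun _ _ _ hM => hM φ h

-- Simulating the Π₁ theorems of the external system

section Simulation

variable {L' : FirstOrder.Language.{0, 0}} {ι : ξ.A.L →ᴸ L'} {𝓑 : Set (Sent L')}
  {D : DeductionMethod L'} {τ : Fml ξ.A.L 2} {G : ξ.Sentence}

variable {ξ}

theorem IsGlobSim.piSent (hτ : τ ∈ ξ.TestList) (h : ξ.IsGlobSim ι 𝓑 D τ G) :
    ξ.PiSent 1 G := by
  obtain ⟨π, χ, hπ, hχ, rfl⟩ := h
  exact ξ.piSent_globSim hπ.1 hχ.1 hτ.1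

/-- A `t` passing `Check` codes a Π₁ sentence, and a proof of it makes it true, so every instance of
its test holds by the defining property of `TestList`. -/
theorem IsGlobSim.holds (hτ : τ ∈ ξ.TestList)
    (htrue : ∀ Ψ : ξ.Sentence, ξ.PiSent 1 Ψ → D.Proves 𝓑 (Ψ.map ι) → ξ.A.Holds Ψ)
    (h : ξ.IsGlobSim ι 𝓑 D τ G) : ξ.A.Holds G := by
  obtain ⟨π, χ, hπ, hχ, rfl⟩ := h
  refine (ξ.realize_globSim π τ χ).2 fun t q x ⟨hπt, hχt⟩ => ?_
  obtain ⟨Ψ, hΨ, hΨt⟩ := (hχ.2 _).1 hχt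
  obtain rfl : ξ.code Ψ = t := hΨt
  exact (hτ.2 Ψ hΨ).1 (htrue Ψ hΨ ⟨q, (hπ.2 Ψ q).1 hπt⟩) x

theorem IsGlobSim.proves_braced (h : ξ.IsGlobSim ι 𝓑 D τ G) {Φ Ψ : ξ.Sentence}
    (hΨ : D.Proves 𝓑 (Ψ.map ι)) (hbr : ξ.Braced Φ τ Ψ) {α : Set ξ.Sentence} (hα : ξ.B ⊆ α)
    (hΦα : Φ ∈ α) (hGα : G ∈ α) : ξ.d.Proves α Ψ := by
  obtain ⟨π, χ, hπ, hχ, rfl⟩ := h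
  obtain ⟨q, hq⟩ := hΨ
  refine ξ.proves_of_imp hα (hbr.2.mono (Set.union_subset hα (by simpa using hΦα))) ?_
  -- The true Δ₀ sentence stating that the actual proof `q` proves `Ψ`; it is Σ₁, so `B` proves it.
  let X : ξ.Sentence := .and (π.subst ![ξ.A.num (ξ.code Ψ), ξ.A.num q])
    (χ.subst ![ξ.A.num (ξ.code Ψ)])
  have hX : ξ.d.Proves α X := by
    refine (ξ.sigma_complete X (.base (ξ.Δ.and (ξ.Δ.subst _ (fun a => ?_) hπ.1)
      (ξ.Δ.subst _ (fun a => ?_) hχ.1))) ⟨?_, ?_⟩).mono hα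
    · fin_cases a
      exacts [.inr ⟨_, rfl⟩, .inr ⟨_, rfl⟩]
    · fin_cases a
      exact .inr ⟨_, rfl⟩
    · rw [realizeOn_subst_pair]
      simpa [Fml.Realize] using (hπ.2 Ψ q).2 hq
    · rw [realizeOn_subst_single]
      simpa [Fml.Realize] using (hχ.2 ![ξ.code Ψ]).2 ⟨Ψ, hbr.1, rfl⟩
  -- In any model, `G` is instantiated at the values of the two numerals, which may be arbitrary
  -- elements; only their agreement with those in `X` matters.
  refine ξ.indirect_implication α X _ _ hα hX (ξ.proves_of_mem hα hGα)
    (ξ.complete α _ hα fun M _ _ _ hc => ?_)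
  obtain ⟨⟨hπM, hχM⟩, hG⟩ := hc
  intro a _
  rw [realizeOn_subst_pair] at hπM ⊢
  rw [realizeOn_subst_single] at hχM
  simp only [ξ.A.realize_num] at hπM hχM ⊢
  exact (ξ.realize_globSim π τ χ).1 hG _ _ a ⟨hπM, hχM⟩

end Simulation

end GenericConfiguration

end SelfJust

theorem theoremG2 (ξ : GenericConfiguration)
    {L' : FirstOrder.Language.{0, 0}} (ι : ξ.A.L →ᴸ L') (𝓑 : Set (Sent L'))
    (D : DeductionMethod L')
    (hPrf : ∃ π, ξ.IsPrfFormula ι 𝓑 D π)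
    (htrue : ∀ Ψ : ξ.Sentence, ξ.PiSent 1 Ψ → D.Proves 𝓑 (Ψ.map ι) → ξ.A.Holds Ψ)
    (Φ : ξ.Sentence) (hΦ : ξ.PiSent 1 Φ) (hΦtrue : ξ.A.Holds Φ)
    (τ : Fml ξ.A.L 2) (hτ : τ ∈ ξ.TestList) (k : ℕ)
    (hk : k = 1 ∧ ξ.EAStable ∨ k = 0 ∧ (ξ.EStable ∨ ξ.AStable ∨ ξ.ZeroStable)) :
    (∃ G, ξ.IsGlobSim ι 𝓑 D τ G) ∧
    ∀ G, ξ.IsGlobSim ι 𝓑 D τ G →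
      (∃ S, ξ.IsSelfCons k (ξ.B ∪ {Φ, G}) S) ∧
      ∀ S, ξ.IsSelfCons k (ξ.B ∪ {Φ, G}) S →
        ξ.PiSent 1 G ∧ ξ.PiSent 1 S ∧
        ξ.SelfJustifying k (ξ.B ∪ {Φ, G, S}) ∧
        ∀ Ψ : ξ.Sentence, D.Proves 𝓑 (Ψ.map ι) → ξ.Braced Φ τ Ψ →
          ξ.d.Proves (ξ.B ∪ {Φ, G, S}) Ψ := by
  have hk₁ : k ≤ 1 := by rcases hk with ⟨rfl, -⟩ | ⟨rfl, -⟩ <;> norm_num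
  constructor
  · obtain ⟨π, hπ⟩ := hPrf
    obtain ⟨χ, hχ⟩ := ξ.exists_isCheck
    exact ⟨_, π, χ, hπ, hχ, rfl⟩
  refine fun G hG => ⟨ξ.exists_isSelfCons hk₁ Φ G, fun S hS => ?_⟩
  have hα : ξ.B ∪ {Φ, G, S} = ξ.B ∪ {Φ, G} ∪ {S} := by
    ext; simp; tauto
  have hB : ξ.B ⊆ ξ.B ∪ {Φ, G, S} := Set.subset_union_left
  have hStrue := hS.holds hk hΦ hΦtrue (hG.piSent hτ) (hG.holds hτ htrue)
  have hlevel : ξ.LevelConsistent k (ξ.B ∪ {Φ, G, S}) := by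
    rw [ξ.levelConsistent_iff, hα]
    -- Unrestricted truth of `S` in `ℕ` is the Level(k) consistency of the system.
    simpa using (hS.realizeOn_iff Set.univ).1 hStrue
  refine ⟨hG.piSent hτ, hS.piSent, ⟨?_, hlevel, hlevel.consistent hk₁ hB⟩, fun Ψ hΨ hbr =>
    hG.proves_braced hΨ hbr hB (by simp) (by simp)⟩
  obtain ⟨S', hS', hent⟩ := hS.exists_statesLevelConsistency
  refine ⟨S', hα ▸ hS', ξ.complete _ _ hB fun M _ _ hM => hent M ?_⟩
  rintro _ rfl
  exact hM _ (by simp)
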